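/- Let $R$ be a commutative noetherian ring. Let $D^-(\mathrm{mod}\,R)$ be the derived category of complexes $X$ of finitely generated $R$-modules with $H^i(X)=0$ for all $i\gg 0$, regarded as a tensor triangulated category via the derived tensor product $\otimes^{\mathbf L}_R$. A thick tensor ideal of $D^-(\mathrm{mod}\,R)$ is a thick subcategory $\mathcal X$ (a triangulated subcategory closed under direct summands) such that $T\otimes^{\mathbf L}_R X\in\mathcal X$ for all $T\in D^-(\mathrm{mod}\,R)$ and $X\in\mathcal X$; it is prime if it is proper and $X\otimes^{\mathbf L}_R Y\in\mathcal X$ implies $X\in\mathcal X$ or $Y\in\mathcal X$. The Balmer spectrum $\mathrm{Spc}\,D^-(\mathrm{mod}\,R)$ is the set of prime thick tensor ideals, with the topology having as an open basis the sets $\{\mathcal P : X\in\mathcal P\}$ for $X\in D^-(\mathrm{mod}\,R)$. If $\mathrm{Spc}\,D^-(\mathrm{mod}\,R)$ is a noetherian topological space (every descending chain of closed subsets stabilizes), then $\mathrm{Spec}\,R$ is a finite set; in particular, $R$ is semi-local (has only finitely many maximal ideals) and has Krull dimension at most $1$. -/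

import Mathlib

open CategoryTheory CategoryTheory.Limits

universe w v u

namespace BalmerSpectrum

/-! ### The Balmer spectrum -/

section Spectrum

variable {T : Type u} [Category.{v} T] [Preadditive T] [HasZeroObject T] [HasShift T ℤ]
  [∀ n : ℤ, (shiftFunctor T n).Additive] [Pretriangulated T]

/-- A full subcategory `I` of a triangulated category `T` with tensor product `tensor` is a thick
tensor ideal if it is a triangulated subcategory, closed under retracts (direct summands; in
particular under isomorphisms), and `t ⊗ x` belongs to `I` for all `t` in `T` and `x` in `I`.
Only the values of the tensor product on objects enter. -/
structure IsThickTensorIdeal (tensor : T → T → T) (I : ObjectProperty T) : Prop where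
  isTriangulated : I.IsTriangulated
  isStableUnderRetracts : I.IsStableUnderRetracts
  tensor_mem : ∀ t x : T, I x → I (tensor t x)

/-- A prime thick tensor ideal: a proper thick tensor ideal `P` such that `x ⊗ y ∈ P` implies
`x ∈ P` or `y ∈ P`. -/
structure IsPrimeThickTensorIdeal (tensor : T → T → T) (P : ObjectProperty T) : Prop extends
    IsThickTensorIdeal tensor P where
  proper : ∃ x : T, ¬ P x
  mem_or_mem : ∀ x y : T, P (tensor x y) → P x ∨ P y

/-- The set of prime thick tensor ideals of `T`. -/
def Spc (tensor : T → T → T) : Type u :=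
  {P : ObjectProperty T // IsPrimeThickTensorIdeal tensor P}

/-- The Balmer support of an object: the prime thick tensor ideals that do not contain it. -/
def Spc.supp (tensor : T → T → T) (x : T) : Set (Spc tensor) :=
  {P | ¬ P.1 x}

/-- The topology on the Balmer spectrum generated by the complements of the Balmer supports
of objects. -/
instance (tensor : T → T → T) : TopologicalSpace (Spc tensor) :=
  TopologicalSpace.generateFrom (Set.range fun x : T ↦ (Spc.supp tensor x)ᶜ)

end Spectrum

/-! ### Projective resolutions of right bounded complexes -/

theorem quasiIso_opEquivalence_inverse {C : Type u} [Category.{v} C] [Abelian C]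
    {K L : CochainComplex Cᵒᵖ ℤ} (f : K ⟶ L) [QuasiIso f] :
    QuasiIso ((CochainComplex.opEquivalence C).inverse.map f).unop := by
  rw [quasiIso_iff]
  intro n
  rw [quasiIsoAt_iff' _ (n - 1) n (n + 1) (by simp) (by simp), ← ShortComplex.quasiIso_opMap_iff]
  have h : QuasiIsoAt f (-n) := inferInstance
  rw [quasiIsoAt_iff' _ (-(n + 1)) (-n) (-(n - 1)) (by simp; lia) (by simp; lia)] at h
  exact h

theorem exists_projective_quasiIso {C : Type u} [Category.{v} C] [Abelian C]
    [EnoughProjectives C] (K : CochainComplex C ℤ) (n : ℤ) [K.IsStrictlyLE n] :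
    ∃ (P : CochainComplex C ℤ) (π : P ⟶ K), QuasiIso π ∧ (∀ i, Projective (P.X i)) ∧
      P.IsStrictlyLE n := by
  let E := CochainComplex.opEquivalence C
  have hK : (E.functor.obj (.op K)).IsStrictlyGE (-n) := by
    rw [CochainComplex.isStrictlyGE_iff]
    intro i hi
    exact (K.isZero_of_isStrictlyLE n (-i) (by lia)).op
  obtain ⟨L, f, hf, hL, hn⟩ :=
    CochainComplex.Plus.modelCategoryQuillen.exists_quasiIso_injective
      (E.functor.obj (.op K)) (-n)
  have := quasiIso_opEquivalence_inverse f
  refine ⟨(E.inverse.obj L).unop, (E.inverse.map f).unop ≫ (E.unitIso.app (.op K)).hom.unop,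
    inferInstance, fun i ↦ ?_, ?_⟩
  · have := hL (-i)
    exact inferInstanceAs (Projective (L.X (-i)).unop)
  · rw [CochainComplex.isStrictlyLE_iff]
    intro i hi
    exact (L.isZero_of_isStrictlyGE (-n) (-i) (by lia)).unop

section FGModules

variable (R : Type u) [CommRing R]

theorem moduleProjective_of_projective (M : FGModuleCat.{u} R)
    [Projective M] : Module.Projective R M := by
  obtain ⟨n, f, hf⟩ := Module.Finite.exists_fin' R M
  let g : FGModuleCat.of R (Fin n → R) ⟶ M := FGModuleCat.ofHom f
  have : Epi g := (forget₂ (FGModuleCat.{u} R) (ModuleCat.{u} R)).epi_of_epi_map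
    ((ModuleCat.epi_iff_surjective _).mpr hf)
  refine Module.Projective.of_split (M := Fin n → R) (Projective.factorThru (𝟙 M) g).hom.hom f ?_
  exact congrArg (fun h ↦ h.hom.hom) (Projective.factorThru_comp (𝟙 M) g)

theorem enoughProjectives_fgModuleCat [IsNoetherianRing R] :
    EnoughProjectives (FGModuleCat.{u} R) where
  presentation M := by
    obtain ⟨n, f, hf⟩ := Module.Finite.exists_fin' R M
    exact ⟨{
      p := FGModuleCat.of R (Fin n → R)
      projective := ⟨fun {E X} a e he ↦ by
        have he' : Function.Surjective e.hom.hom := (ModuleCat.epi_iff_surjective _).mp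
          (inferInstanceAs (Epi ((forget₂ (FGModuleCat.{u} R) (ModuleCat.{u} R)).map e)))
        obtain ⟨b, hb⟩ := Module.projective_lifting_property e.hom.hom a.hom.hom he'
        exact ⟨FGModuleCat.ofHom b, FGModuleCat.hom_ext hb⟩⟩
      f := FGModuleCat.ofHom f
      epi := (forget₂ (FGModuleCat.{u} R) (ModuleCat.{u} R)).epi_of_epi_map
        ((ModuleCat.epi_iff_surjective _).mpr hf) }⟩

variable [IsNoetherianRing R] [HasDerivedCategory.{w} (FGModuleCat.{u} R)]

/-- The right bounded derived category of finitely generated `R`-modules: the full subcategory of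
the derived category of the abelian category of finitely generated `R`-modules consisting of the
complexes `X` with `Hⁱ(X) = 0` for `i ≫ 0`. -/
abbrev DMinus : Type (u + 1) := DerivedCategory.Minus (FGModuleCat.{u} R)

variable {R}

/-- A projective resolution of `X`: a bounded above complex of finitely generated projective
`R`-modules that is isomorphic to `X` in the derived category. -/
structure ProjRes (X : DMinus.{w} R) where
  complex : CochainComplex (FGModuleCat.{u} R) ℤ
  bound : ℤ
  isStrictlyLE : complex.IsStrictlyLE bound
  projective : ∀ i : ℤ, Module.Projective R (complex.X i)
  iso : DerivedCategory.Q.obj complex ≅ X.obj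

theorem nonempty_projRes (X : DMinus.{w} R) : Nonempty (ProjRes X) := by
  have := enoughProjectives_fgModuleCat R
  obtain ⟨X, n, K, e, hK⟩ := X
  obtain ⟨P, π, hπ, hP, hn⟩ := exists_projective_quasiIso K n
  exact ⟨⟨P, n, hn, fun i ↦ have := hP i; moduleProjective_of_projective R (P.X i),
    asIso (DerivedCategory.Q.map π) ≪≫ e.symm⟩⟩

/-- A chosen projective resolution of `X`. -/
noncomputable def projRes (X : DMinus.{w} R) : ProjRes X :=
  Classical.choice (nonempty_projRes X)

end FGModules

/-! ### Tensor products of bounded above complexes -/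

section Tensor

theorem hasCoproduct_of_finite_support {C : Type u} [Category.{v} C] [HasZeroMorphisms C]
    [HasFiniteCoproducts C] {J : Type*} (X : J → C) (s : Set J) [Finite s]
    (hs : ∀ j, j ∉ s → IsZero (X j)) : HasCoproduct X := by
  classical
  let Y : s → C := fun j ↦ X j
  let ιX : ∀ j, X j ⟶ ∐ Y := fun j ↦ if h : j ∈ s then Limits.Sigma.ι Y ⟨j, h⟩ else 0
  have hι (j : s) : ιX j.1 = Limits.Sigma.ι Y j := dif_pos j.2
  refine ⟨⟨Cofan.mk _ ιX, Cofan.IsColimit.mk _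
    (fun t ↦ Limits.Sigma.desc (f := Y) fun j ↦ t.inj j.1) (fun t j ↦ ?_) (fun t m hm ↦ ?_)⟩⟩
  · by_cases h : j ∈ s
    · change ιX j ≫ _ = _
      rw [hι ⟨j, h⟩, Limits.Sigma.ι_desc]
    · exact (hs j h).eq_of_src _ _
  · refine Limits.Sigma.hom_ext (f := Y) _ _ fun j ↦ ?_
    rw [Limits.Sigma.ι_desc (f := Y), ← hι]
    exact hm j.1

variable {R : Type u} [CommRing R]

open MonoidalCategory in
theorem isZero_tensor (M N : FGModuleCat.{u} R) (h : IsZero M ∨ IsZero N) : IsZero (M ⊗ N) := by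
  rcases h with h | h
  · exact (tensorRight N).map_isZero h
  · exact (tensorLeft M).map_isZero h

variable (K L : CochainComplex (FGModuleCat.{u} R) ℤ)

theorem hasTensor_of_isStrictlyLE [IsNoetherianRing R] (a b : ℤ)
    (hK : K.IsStrictlyLE a) (hL : L.IsStrictlyLE b) : HomologicalComplex.HasTensor K L := by
  intro j
  let s : Set ((ComplexShape.π (.up ℤ) (.up ℤ) (.up ℤ)) ⁻¹' {j}) :=
    {p | p.1.1 ≤ a ∧ p.1.2 ≤ b}
  have : Finite s := by
    refine Finite.of_injective (β := Set.Icc (j - b) a) (fun p ↦ ⟨p.1.1.1, ?_, p.2.1⟩) ?_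
    · have h1 : p.1.1.1 + p.1.1.2 = j := p.1.2
      have h2 := p.2.2
      lia
    · rintro ⟨⟨⟨x, y⟩, h⟩, h'⟩ ⟨⟨⟨x', y'⟩, k⟩, k'⟩ e
      have h1 : x + y = j := h
      have k1 : x' + y' = j := k
      have e1 : x = x' := congrArg Subtype.val e
      have e2 : y = y' := by lia
      subst e1 e2
      rfl
  refine hasCoproduct_of_finite_support _ s fun p hp ↦ isZero_tensor (K.X p.1.1) (L.X p.1.2) ?_
  by_cases h : p.1.1 ≤ a
  · exact .inr (L.isZero_of_isStrictlyLE b _ (by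
      by_contra h'; exact hp ⟨h, by lia⟩))
  · exact .inl (K.isZero_of_isStrictlyLE a _ (by lia))

theorem tensorObj_isStrictlyLE (a b : ℤ) (hK : K.IsStrictlyLE a)
    (hL : L.IsStrictlyLE b) [HomologicalComplex.HasTensor K L] :
    CochainComplex.IsStrictlyLE (HomologicalComplex.tensorObj K L) (a + b) := by
  rw [CochainComplex.isStrictlyLE_iff]
  intro i hi
  rw [IsZero.iff_id_eq_zero]
  apply HomologicalComplex.mapBifunctor.hom_ext
  intro p q hpq
  refine (isZero_tensor (K.X p) (L.X q) ?_).eq_of_src _ _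
  have hpq' : p + q = i := hpq
  by_cases h : p ≤ a
  · exact .inr (L.isZero_of_isStrictlyLE b _ (by lia))
  · exact .inl (K.isZero_of_isStrictlyLE a _ (by lia))

variable [IsNoetherianRing R] [HasDerivedCategory.{w} (FGModuleCat.{u} R)]

/-- The derived tensor product `X ⊗ᴸ Y`: the total tensor product complex `P ⊗ Q` of projective
resolutions `P` of `X` and `Q` of `Y`. Up to isomorphism it does not depend on the resolutions. -/
noncomputable def derivedTensor (X Y : DMinus.{w} R) : DMinus.{w} R :=
  letI P := projRes X
  letI Q := projRes Y
  haveI : HomologicalComplex.HasTensor P.complex Q.complex :=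
    hasTensor_of_isStrictlyLE _ _ P.bound Q.bound P.isStrictlyLE Q.isStrictlyLE
  ⟨DerivedCategory.Q.obj (HomologicalComplex.tensorObj P.complex Q.complex),
    P.bound + Q.bound,
    ⟨⟨_, Iso.refl _, tensorObj_isStrictlyLE _ _ _ _ P.isStrictlyLE Q.isStrictlyLE⟩⟩⟩

end Tensor

/-- The Balmer spectrum of the right bounded derived category of finitely generated `R`-modules,
with respect to the derived tensor product. -/
abbrev SpcDMinus (R : Type u) [CommRing R] [IsNoetherianRing R]
    [HasDerivedCategory.{w} (FGModuleCat.{u} R)] :=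
  Spc (derivedTensor (R := R))

end BalmerSpectrum

/-! For a prime `p`, the complexes acyclic at `p` form a prime thick tensor ideal
(`isPrimeThickTensorIdeal_locallyAcyclic`). If Spec R is infinite, there are primes p_0, p_1, … with
p_n ⊄ p_m for m < n. The sum K_m of the (R/p_i)[i] with i ≥ m, bounded above but not below, lies in
the ideal P_n of p_n exactly when n < m. The open sets {K_m ∈ P} thus cover {P_n}, and each contains
only finitely many P_n, so {P_n} is not compact; but every subset of a noetherian space is compact.
The dimension bound follows from finiteness by Krull's principal ideal theorem and prime avoidance.

No localization is formed: acyclicity at `p` means that each cohomology module is killed by some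
element outside `p`. Both tensor properties rest on `exists_homotopy_smul_id`, which makes such an
element act, up to homotopy, by a map vanishing in high degrees. Primality replaces Künneth over the
residue field by a pairing: objects outside the ideal have cocycles with values in the domain R/p
that are nonzero on a cycle, and products of these remain nonzero. -/

namespace BalmerSpectrum

/-! ### Annihilators of objects in linear categories -/

section Annihilators

variable {R : Type*} [CommRing R] {C : Type u} [Category.{v} C] [Preadditive C] [Linear R C]

theorem smul_id_eq_zero_of_retract {X Y : C} (e : Retract X Y) {s : R} (h : s • 𝟙 Y = 0) :
    s • 𝟙 X = 0 := by
  have : s • 𝟙 X = e.i ≫ (s • 𝟙 Y) ≫ e.r := by simp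
  rw [this, h, zero_comp, comp_zero]

/-- Multiplication by `t` on the middle term factors through the kernel of `S.g`, which is the image
of `S.X₁` and so is killed by `s`. -/
theorem mul_smul_id_eq_zero_of_exact {S : ShortComplex C} [Balanced C] (hS : S.Exact)
    [S.HasHomology] {s t : R}
    (hs : s • 𝟙 S.X₁ = 0) (ht : t • 𝟙 S.X₃ = 0) : (s * t) • 𝟙 S.X₂ = 0 := by
  have := hS.epi_toCycles
  have h₁ : s • S.iCycles = 0 := by
    rw [← cancel_epi S.toCycles, Linear.comp_smul, S.toCycles_i, comp_zero]
    rw [← Category.id_comp S.f, ← Linear.smul_comp, hs, zero_comp]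
  have h₂ : (t • 𝟙 S.X₂) ≫ S.g = 0 := by
    rw [Linear.smul_comp, Category.id_comp, ← Category.comp_id S.g, ← Linear.comp_smul, ht,
      comp_zero]
  rw [mul_smul, ← S.liftCycles_i (t • 𝟙 S.X₂) h₂, ← Linear.comp_smul, h₁, comp_zero]

end Annihilators

/-! ### Scalars killing cohomology, up to homotopy -/

section Complexes

variable {R : Type*} [CommRing R] {C : Type u} [Category.{v} C] [Abelian C] [Linear R C]

theorem homologyMap_smul_id (K : CochainComplex C ℤ) (s : R) (n : ℤ) :
    HomologicalComplex.homologyMap (s • 𝟙 K) n = s • 𝟙 (K.homology n) := by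
  have : HomologicalComplex.homologyMap (s • 𝟙 K) n =
      s • HomologicalComplex.homologyMap (𝟙 K) n :=
    ShortComplex.homologyMap_smul (φ := (HomologicalComplex.shortComplexFunctor C _ n).map (𝟙 K)) s
  rw [this, HomologicalComplex.homologyMap_id]

/-- If `t` annihilates `Hⁱ(K)`, then `t` times a cocycle with projective source is a
coboundary. -/
theorem exists_comp_d_eq_smul (K : CochainComplex C ℤ) {i j k : ℤ} (hij : i + 1 = j)
    (hjk : j + 1 = k) {t : R} (ht : t • 𝟙 (K.homology j) = 0) {P : C} [Projective P]
    (x : P ⟶ K.X j) (hx : x ≫ K.d j k = 0) : ∃ y : P ⟶ K.X i, y ≫ K.d i j = t • x := by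
  have hk : (ComplexShape.up ℤ).next j = k := by simp [hjk]
  have hi : (ComplexShape.up ℤ).prev j = i := by simp; lia
  let c := K.liftCycles x k hk hx
  have hc : (t • c) ≫ K.homologyπ j = 0 := by
    rw [Linear.smul_comp, ← Linear.comp_smul, ← Category.comp_id (K.homologyπ j),
      ← Linear.comp_smul, ht, comp_zero, comp_zero]
  have hex : (ShortComplex.mk (K.toCycles i j) (K.homologyπ j) (by simp)).Exact :=
    ShortComplex.exact_of_g_is_cokernel _ (K.homologyIsCokernel i j hi)
  refine ⟨hex.liftFromProjective (t • c) hc, ?_⟩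
  have := hex.liftFromProjective_comp (t • c) hc
  dsimp only at this
  rw [← K.toCycles_i i j, reassoc_of% this, Linear.smul_comp, K.liftCycles_i]

/-- A bounded above complex of projectives whose cohomology in degrees `≥ n` is annihilated by
elements of a submonoid `S` has an endomorphism that is homotopic to the multiplication by an
element of `S` and vanishes in degrees `≥ n`. -/
theorem exists_homotopy_smul_id (P : CochainComplex C ℤ) (b : ℤ) [P.IsStrictlyLE b]
    (hP : ∀ i, Projective (P.X i)) (S : Submonoid R) (n : ℤ)
    (hS : ∀ i, n ≤ i → ∃ s ∈ S, s • 𝟙 (P.homology i) = 0) :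
    ∃ s ∈ S, ∃ f : P ⟶ P, Nonempty (Homotopy (s • 𝟙 P) f) ∧ ∀ i, n ≤ i → f.f i = 0 := by
  by_cases hn : b < n
  · refine ⟨1, S.one_mem, 𝟙 P, ⟨Homotopy.ofEq (one_smul _ _)⟩, fun i hi ↦ ?_⟩
    exact (P.isZero_of_isStrictlyLE b i (by lia)).eq_of_src _ _
  replace hn : n ≤ b + 1 := by lia
  induction n, hn using Int.leInductionDown with
  | base =>
    refine ⟨1, S.one_mem, 𝟙 P, ⟨Homotopy.ofEq (one_smul _ _)⟩, fun i hi ↦ ?_⟩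
    exact (P.isZero_of_isStrictlyLE b i (by lia)).eq_of_src _ _
  | pred n hn ih =>
    obtain ⟨s, hs, f, ⟨h⟩, hf⟩ := ih fun i hi ↦ hS i (by lia)
    obtain ⟨t, ht, ht'⟩ := hS (n - 1) le_rfl
    have := hP (n - 1)
    obtain ⟨y, hy⟩ := exists_comp_d_eq_smul P (i := n - 1 - 1) (k := n) (by lia) (by lia) ht'
      (f.f (n - 1)) (by rw [f.comm, hf n le_rfl, comp_zero])
    -- The only nonzero component is `y`, from degree n - 1 to n - 2. Its null-homotopic map is `t •
    -- f` in degree n - 1 and zero in degrees ≥ n, so subtracting it extends the vanishing range by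
    -- one.
    let g : ∀ i j, (ComplexShape.up ℤ).Rel j i → (P.X i ⟶ P.X j) := fun i j hij ↦
      if hi : i = n - 1 then
        eqToHom (by rw [hi]) ≫ y ≫ eqToHom (by
          have hij : j + 1 = i := hij
          congr 1; lia) else 0
    refine ⟨t * s, S.mul_mem ht hs, t • f - Homotopy.nullHomotopicMap' g, ⟨?_⟩, fun i hi ↦ ?_⟩
    · refine (Homotopy.ofEq (mul_smul t s (𝟙 P))).trans ((h.smul t).trans ?_)
      exact (Homotopy.equivSubZero.symm ((Homotopy.ofEq (by abel)).trans
        (Homotopy.nullHomotopy' g)))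
    · have h₁ : (ComplexShape.up ℤ).Rel (i - 1) i := by simp
      have h₂ : (ComplexShape.up ℤ).Rel i (i + 1) := by simp
      rw [HomologicalComplex.sub_f_apply, HomologicalComplex.smul_f_apply,
        Homotopy.nullHomotopicMap'_f h₁ h₂]
      have : g (i + 1) i h₂ = 0 := dif_neg (by lia)
      rw [this, comp_zero, zero_add, sub_eq_zero]
      by_cases hi' : i = n - 1
      · subst hi'
        rw [← hy]
        simp [g]
      · have : g i (i - 1) h₁ = 0 := dif_neg hi'
        rw [this, hf i (by lia), smul_zero, zero_comp]

end Complexes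

/-! ### Pairings with values in R/p, and tensor products -/

section FGModules

variable {R : Type u} [CommRing R]

theorem projective_of_moduleProjective [IsNoetherianRing R] (M : FGModuleCat.{u} R)
    [Module.Projective R M] : Projective M where
  factors {E X} a e he := by
    have he' : Function.Surjective e.hom.hom := (ModuleCat.epi_iff_surjective _).mp
      (inferInstanceAs (Epi ((forget₂ (FGModuleCat.{u} R) (ModuleCat.{u} R)).map e)))
    obtain ⟨b, hb⟩ := Module.projective_lifting_property e.hom.hom a.hom.hom he'
    exact ⟨FGModuleCat.ofHom b, FGModuleCat.hom_ext hb⟩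

theorem smul_id_eq_zero_iff (M : FGModuleCat.{u} R) (s : R) :
    s • 𝟙 M = 0 ↔ s ∈ Module.annihilator R M := by
  rw [Module.mem_annihilator]
  refine ⟨fun h x ↦ ?_, fun h ↦ FGModuleCat.hom_ext (LinearMap.ext h)⟩
  exact congrArg (fun f ↦ f.hom.hom x) h

open TensorProduct in
/-- A finitely generated module over a noetherian ring that is not annihilated by any element
outside the prime ideal `p` has a nonzero morphism to `R ⧸ p`. -/
theorem exists_linearMap_quotient_ne_zero [IsNoetherianRing R] (M : Type u) [AddCommGroup M]
    [Module R M] [Module.Finite R M] (p : Ideal R) [p.IsPrime]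
    (h : Module.annihilator R M ≤ p) : ∃ χ : M →ₗ[R] R ⧸ p, χ ≠ 0 := by
  have hp : (⟨p, inferInstance⟩ : PrimeSpectrum R) ∈ Module.support R M := by
    rw [Module.support_eq_zeroLocus]
    exact h
  rw [Module.mem_support_iff_nontrivial_residueField_tensorProduct] at hp
  obtain ⟨x, hx⟩ : ∃ x : M, (1 : p.ResidueField) ⊗ₜ[R] x ≠ 0 := by
    by_contra! h0
    obtain ⟨y, hy⟩ := exists_ne (0 : p.ResidueField ⊗[R] M)
    refine hy ?_
    clear hy
    induction y with
    | zero => rfl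
    | tmul c m =>
      rw [← mul_one c, ← smul_eq_mul, ← TensorProduct.smul_tmul', h0, smul_zero]
    | add y z hy hz => rw [hy, hz, add_zero]
  -- A functional on the fibre gives an `R`-linear map from `M` to the residue field; a common
  -- denominator for the finitely many generators then moves its image into R/p.
  obtain ⟨f, hf⟩ : ∃ f : Module.Dual p.ResidueField (p.ResidueField ⊗[R] M), f (1 ⊗ₜ x) ≠ 0 := by
    by_contra! h0
    exact hx ((Module.forall_dual_apply_eq_zero_iff _ _).mp h0)
  let g : M →ₗ[R] p.ResidueField :=
    f.restrictScalars R ∘ₗ TensorProduct.mk R p.ResidueField M 1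
  let j : (R ⧸ p) →ₗ[R] p.ResidueField :=
    (IsScalarTower.toAlgHom R (R ⧸ p) p.ResidueField).toLinearMap
  have hj : Function.Injective j := FaithfulSMul.algebraMap_injective (R ⧸ p) p.ResidueField
  obtain ⟨S, hS⟩ := ‹Module.Finite R M›.fg_top
  classical
  obtain ⟨b, hb⟩ := IsLocalization.exist_integer_multiples_of_finset
    (nonZeroDivisors (R ⧸ p)) (S.image g)
  obtain ⟨r, hr⟩ := Ideal.Quotient.mk_surjective (b : R ⧸ p)
  have hrb (c : p.ResidueField) : r • c = (b : R ⧸ p) • c := by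
    rw [← hr, ← Ideal.Quotient.algebraMap_eq, algebraMap_smul]
  have hrange (m : M) : (r • g) m ∈ LinearMap.range j := by
    have : (⊤ : Submodule R M) ≤ (LinearMap.range j).comap (r • g) := by
      rw [← hS, Submodule.span_le]
      intro m hm
      obtain ⟨c, hc⟩ := hb (g m) (Finset.mem_image_of_mem g hm)
      exact ⟨c, hc.trans (hrb _).symm⟩
    exact this trivial
  refine ⟨(LinearEquiv.ofInjective j hj).symm ∘ₗ LinearMap.codRestrict _ (r • g) hrange,
    fun h0 ↦ ?_⟩
  have h1 : (LinearEquiv.ofInjective j hj).symm (⟨(r • g) x, hrange x⟩) = 0 :=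
    LinearMap.congr_fun h0 x
  rw [LinearEquiv.symm_apply_eq, map_zero, Subtype.ext_iff] at h1
  change r • g x = 0 at h1
  rw [hrb, Algebra.smul_def, mul_eq_zero] at h1
  refine h1.elim (fun h2 ↦ nonZeroDivisors.coe_ne_zero b ?_) hf
  exact FaithfulSMul.algebraMap_injective (R ⧸ p) p.ResidueField (h2.trans (map_zero _).symm)

-- In total degree n, a nonzero summand has K-degree at most `a`, hence L-degree at least n - a,
-- where `f` vanishes. So the map id ⊗ f, homotopic to `s`, is zero in degree n.
open MonoidalCategory in
theorem tensor_smul_id_eq_zero [IsNoetherianRing R] (K L : CochainComplex (FGModuleCat.{u} R) ℤ)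
    (a : ℤ) [hK : K.IsStrictlyLE a] [HomologicalComplex.HasTensor K L] {s : R} {f : L ⟶ L}
    (h : Homotopy (s • 𝟙 L) f) (n : ℤ) (hf : ∀ i, n - a ≤ i → f.f i = 0) :
    s • 𝟙 ((HomologicalComplex.tensorObj K L).homology n) = 0 := by
  have h₁ : HomologicalComplex.tensorHom (𝟙 K) (s • 𝟙 L) =
      s • 𝟙 (HomologicalComplex.tensorObj K L) := by
    ext1 m
    refine HomologicalComplex.mapBifunctor.hom_ext fun i j hij ↦ ?_
    simp
  have h₂ : (HomologicalComplex.tensorHom (𝟙 K) f).f n = 0 := by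
    refine HomologicalComplex.mapBifunctor.hom_ext fun i j hij ↦ ?_
    have hij' : i + j = n := hij
    by_cases hi : i ≤ a
    · simp [hf j (by lia)]
    · exact (isZero_tensor (K.X i) (L.X j)
        (.inl (K.isZero_of_isStrictlyLE a _ (by lia)))).eq_of_src _ _
  rw [← homologyMap_smul_id, ← h₁,
    (HomologicalComplex.mapBifunctorMapHomotopy₂ (𝟙 K) h _ _).homologyMap_eq n]
  rw [← cancel_epi (HomologicalComplex.homologyπ _ n), HomologicalComplex.homologyπ_naturality,
    (?_ : HomologicalComplex.cyclesMap _ n = 0), zero_comp, comp_zero]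
  rw [← cancel_mono (HomologicalComplex.iCycles _ n), HomologicalComplex.cyclesMap_i, h₂,
    comp_zero, zero_comp]

/-- A bounded above complex of projectives with a cohomology module that is not annihilated by
any element outside the prime ideal `p` has a cocycle with values in `R ⧸ p` that does not vanish
on some cycle. -/
theorem exists_cocycle_ne_zero [IsNoetherianRing R] (P : CochainComplex (FGModuleCat.{u} R) ℤ)
    (b : ℤ) [P.IsStrictlyLE b] (hP : ∀ i, Projective (P.X i)) (p : Ideal R) [p.IsPrime]
    (h : ¬ ∀ n, ∃ s ∉ p, s • 𝟙 (P.homology n) = 0) :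
    ∃ (a : ℤ) (φ : ∀ i, P.X i ⟶ FGModuleCat.of R (R ⧸ p))
      (z : FGModuleCat.of R R ⟶ P.X a), (∀ i j, P.d i j ≫ φ j = 0) ∧ z ≫ P.d a (a + 1) = 0 ∧
        z ≫ φ a ≠ 0 := by
  push Not at h
  -- The top degree whose cohomology survives at `p`. Above it, elements outside `p` kill the
  -- cohomology, so some `s ∉ p` is homotopic to a map `f` vanishing in degrees > a; hence `f.f a`
  -- lands in cycles and can be followed by a map from cohomology.
  obtain ⟨a, ha, hmax⟩ := Int.exists_greatest_of_bdd
    (P := fun n ↦ ∀ s ∉ p, s • 𝟙 (P.homology n) ≠ 0) ⟨b, fun n hn ↦ by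
      by_contra hb
      refine hn 1 ((Ideal.ne_top_iff_one p).mp Ideal.IsPrime.ne_top')
        (IsZero.eq_of_src ?_ _ _)
      rw [← HomologicalComplex.exactAt_iff_isZero_homology]
      exact ShortComplex.exact_of_isZero_X₂ _ (P.isZero_of_isStrictlyLE b n (by lia))⟩ h
  obtain ⟨s, hs, f, ⟨H⟩, hf⟩ := exists_homotopy_smul_id P b hP p.primeCompl (a + 1) fun i hi ↦ by
    by_contra! hi'
    have := hmax i hi'
    lia
  obtain ⟨χ, hχ⟩ := exists_linearMap_quotient_ne_zero (P.homology a) p fun t ht ↦ by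
    by_contra htp
    exact ha t htp ((smul_id_eq_zero_iff _ _).mpr ht)
  let g : P.homology a ⟶ FGModuleCat.of R (R ⧸ p) := FGModuleCat.ofHom χ
  have hfd : f.f a ≫ P.d a (a + 1) = 0 := by rw [f.comm, hf _ le_rfl, comp_zero]
  let φ : P.X a ⟶ FGModuleCat.of R (R ⧸ p) :=
    P.liftCycles (f.f a) (a + 1) (by simp) hfd ≫ P.homologyπ a ≫ g
  have hφ (i : ℤ) : P.d i a ≫ φ = 0 := by
    have : P.d i a ≫ P.liftCycles (f.f a) (a + 1) (by simp) hfd = f.f i ≫ P.toCycles i a := by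
      rw [← cancel_mono (P.iCycles a)]
      simp
    simp [φ, reassoc_of% this]
  -- On cohomology `f` acts as `s`. Since `s ∉ p` and R/p is a domain, `φ` is nonzero on some cycle.
  have hφ' : P.iCycles a ≫ φ = s • (P.homologyπ a ≫ g) := by
    have : P.iCycles a ≫ P.liftCycles (f.f a) (a + 1) (by simp) hfd =
        HomologicalComplex.cyclesMap f a := by
      rw [← cancel_mono (P.iCycles a)]
      simp
    simp only [φ]
    rw [reassoc_of% this, ← HomologicalComplex.homologyπ_naturality_assoc, ← H.homologyMap_eq,
      homologyMap_smul_id]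
    simp
  obtain ⟨x, hx⟩ : ∃ x : P.homology a, χ x ≠ 0 := by
    by_contra! hx
    exact hχ (LinearMap.ext hx)
  obtain ⟨y, rfl⟩ : ∃ y, (P.homologyπ a).hom.hom y = x :=
    (ModuleCat.epi_iff_surjective _).mp (inferInstanceAs
      (Epi ((forget₂ (FGModuleCat.{u} R) (ModuleCat.{u} R)).map (P.homologyπ a)))) x
  let y' : FGModuleCat.of R R ⟶ P.cycles a := FGModuleCat.ofHom (LinearMap.toSpanSingleton R _ y)
  refine ⟨a, fun i ↦ if hi : i = a then eqToHom (by rw [hi]) ≫ φ else 0, y' ≫ P.iCycles a,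
    fun i j ↦ ?_, by simp, ?_⟩
  · by_cases hj : j = a
    · subst hj
      simp [hφ]
    · simp [hj]
  · intro h0
    have h1 : y' ≫ (s • (P.homologyπ a ≫ g)) = 0 := by
      rw [← hφ']
      simpa using h0
    have h2 : s • χ ((P.homologyπ a).hom.hom ((1 : R) • y)) = 0 :=
      congrArg (fun f ↦ f.hom.hom (1 : R)) h1
    rw [one_smul, Algebra.smul_def, mul_eq_zero] at h2
    exact h2.elim (fun h3 ↦ hs (Ideal.Quotient.eq_zero_iff_mem.mp h3)) hx

-- The product of the two cocycles is a cocycle on `K ⊗ L`. If `s` kills the cohomology, then `s`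
-- times the product cycle is a boundary and pairs to zero; as both factors pair to nonzero elements
-- of the domain R/p, `s` vanishes there.
open MonoidalCategory in
theorem exists_smul_id_ne_zero_tensor [IsNoetherianRing R]
    (K L : CochainComplex (FGModuleCat.{u} R) ℤ) [HomologicalComplex.HasTensor K L]
    (p : Ideal R) [p.IsPrime] {a b : ℤ}
    (φ : ∀ i, K.X i ⟶ FGModuleCat.of R (R ⧸ p)) (hφ : ∀ i j, K.d i j ≫ φ j = 0)
    (ψ : ∀ i, L.X i ⟶ FGModuleCat.of R (R ⧸ p)) (hψ : ∀ i j, L.d i j ≫ ψ j = 0)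
    (z : FGModuleCat.of R R ⟶ K.X a) (hz : z ≫ K.d a (a + 1) = 0) (hzφ : z ≫ φ a ≠ 0)
    (w : FGModuleCat.of R R ⟶ L.X b) (hw : w ≫ L.d b (b + 1) = 0) (hwψ : w ≫ ψ b ≠ 0) (s : R)
    (hs : s • 𝟙 ((HomologicalComplex.tensorObj K L).homology (a + b)) = 0) : s ∈ p := by
  let μ : FGModuleCat.of R (R ⧸ p) ⊗ FGModuleCat.of R (R ⧸ p) ⟶ FGModuleCat.of R (R ⧸ p) :=
    FGModuleCat.ofHom (LinearMap.mul' R (R ⧸ p))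
  let Φ (n : ℤ) : (HomologicalComplex.tensorObj K L).X n ⟶ FGModuleCat.of R (R ⧸ p) :=
    HomologicalComplex.mapBifunctorDesc fun i j _ ↦ (φ i ⊗ₘ ψ j) ≫ μ
  have hΦ (m n : ℤ) : (HomologicalComplex.tensorObj K L).d m n ≫ Φ n = 0 := by
    refine HomologicalComplex.mapBifunctor.hom_ext fun i j hij ↦ ?_
    rw [HomologicalComplex.mapBifunctor.d_eq, Preadditive.add_comp, Preadditive.comp_add,
      HomologicalComplex.mapBifunctor.ι_D₁_assoc, HomologicalComplex.mapBifunctor.ι_D₂_assoc,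
      comp_zero]
    have h₁ : HomologicalComplex.mapBifunctor.d₁ K L (curriedTensor _) (.up ℤ) i j n ≫ Φ n = 0 := by
      by_cases hn : i + 1 + j = n
      · rw [HomologicalComplex.mapBifunctor.d₁_eq _ _ _ _ (i₁' := i + 1) (by simp) _ _ hn,
          Linear.units_smul_comp, Category.assoc, HomologicalComplex.ι_mapBifunctorDesc]
        have : K.d i (i + 1) ▷ L.X j ≫ (φ (i + 1) ⊗ₘ ψ j) = 0 := by
          rw [← tensorHom_id, tensorHom_comp_tensorHom, hφ, MonoidalPreadditive.zero_tensor]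
        dsimp only [curriedTensor_map_app, curriedTensor_obj_map]
        rw [reassoc_of% this, zero_comp, smul_zero]
      · rw [HomologicalComplex.mapBifunctor.d₁_eq_zero' _ _ _ _ (i₁' := i + 1) (by simp) _ _ hn,
          zero_comp]
    have h₂ : HomologicalComplex.mapBifunctor.d₂ K L (curriedTensor _) (.up ℤ) i j n ≫ Φ n = 0 := by
      by_cases hn : i + (j + 1) = n
      · rw [HomologicalComplex.mapBifunctor.d₂_eq _ _ _ _ _ (i₂' := j + 1) (by simp) _ hn,
          Linear.units_smul_comp, Category.assoc, HomologicalComplex.ι_mapBifunctorDesc]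
        have : K.X i ◁ L.d j (j + 1) ≫ (φ i ⊗ₘ ψ (j + 1)) = 0 := by
          rw [← id_tensorHom, tensorHom_comp_tensorHom, hψ, MonoidalPreadditive.tensor_zero]
        dsimp only [curriedTensor_map_app, curriedTensor_obj_map]
        rw [reassoc_of% this, zero_comp, smul_zero]
      · rw [HomologicalComplex.mapBifunctor.d₂_eq_zero' _ _ _ _ _ (i₂' := j + 1) (by simp) _ hn,
          zero_comp]
    rw [h₁, h₂, add_zero]
  let ζ : FGModuleCat.of R R ⊗ FGModuleCat.of R R ⟶
      (HomologicalComplex.tensorObj K L).X (a + b) :=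
    (z ⊗ₘ w) ≫ HomologicalComplex.ιTensorObj K L a b (a + b) rfl
  have hζ : ζ ≫ (HomologicalComplex.tensorObj K L).d (a + b) (a + b + 1) = 0 := by
    simp only [ζ, Category.assoc]
    rw [HomologicalComplex.mapBifunctor.d_eq, Preadditive.comp_add,
      HomologicalComplex.mapBifunctor.ι_D₁, HomologicalComplex.mapBifunctor.ι_D₂,
      HomologicalComplex.mapBifunctor.d₁_eq _ _ _ _ (i₁' := a + 1) (by simp) _ _
        (show a + 1 + b = a + b + 1 by lia),
      HomologicalComplex.mapBifunctor.d₂_eq _ _ _ _ _ (i₂' := b + 1) (by simp) _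
        (show a + (b + 1) = a + b + 1 by lia), Preadditive.comp_add,
      Linear.comp_units_smul, Linear.comp_units_smul]
    have h₁ : (z ⊗ₘ w) ≫ K.d a (a + 1) ▷ L.X b = 0 := by
      rw [← tensorHom_id, tensorHom_comp_tensorHom, hz, MonoidalPreadditive.zero_tensor]
    have h₂ : (z ⊗ₘ w) ≫ K.X a ◁ L.d b (b + 1) = 0 := by
      rw [← id_tensorHom, tensorHom_comp_tensorHom, hw, MonoidalPreadditive.tensor_zero]
    dsimp only [curriedTensor_map_app, curriedTensor_obj_map]
    rw [reassoc_of% h₁, reassoc_of% h₂, zero_comp, zero_comp, smul_zero, smul_zero, add_zero]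
  have : Projective (FGModuleCat.of R R ⊗ FGModuleCat.of R R) := by
    have : Module.Projective R ((FGModuleCat.of R R ⊗ FGModuleCat.of R R : FGModuleCat R)) :=
      inferInstanceAs (Module.Projective R (TensorProduct R R R))
    exact projective_of_moduleProjective _
  obtain ⟨y, hy⟩ := exists_comp_d_eq_smul _ (i := a + b - 1) (by lia) rfl hs ζ hζ
  have h1 : (s • ζ) ≫ Φ (a + b) = 0 := by rw [← hy, Category.assoc, hΦ, comp_zero]
  have h2 : ζ ≫ Φ (a + b) = (z ≫ φ a ⊗ₘ w ≫ ψ b) ≫ μ := by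
    simp only [ζ, Φ, Category.assoc, ← MonoidalCategory.tensorHom_comp_tensorHom]
    rw [HomologicalComplex.ι_mapBifunctorDesc]
  rw [Linear.smul_comp, h2] at h1
  have h3 : s • ((z ≫ φ a).hom.hom (1 : R) * (w ≫ ψ b).hom.hom (1 : R) : R ⧸ p) = 0 :=
    congrArg (fun f ↦ f.hom.hom (TensorProduct.tmul R (1 : R) (1 : R))) h1
  have h4 (f : FGModuleCat.of R R ⟶ FGModuleCat.of R (R ⧸ p)) (hf : f ≠ 0) :
      f.hom.hom (1 : R) ≠ (0 : R ⧸ p) := fun h0 ↦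
    hf (FGModuleCat.hom_ext (LinearMap.ext_ring h0))
  rw [Algebra.smul_def, mul_eq_zero, mul_eq_zero] at h3
  obtain h3 | h3 | h3 := h3
  · exact Ideal.Quotient.eq_zero_iff_mem.mp h3
  · exact (h4 _ hzφ h3).elim
  · exact (h4 _ hwψ h3).elim

end FGModules

/-! ### Complexes with zero differential and cyclic terms -/

section CyclicComplexes

variable {R : Type u} [CommRing R]

/-- The complex with zero differentials and `R ⧸ I n` in degree `n`. -/
noncomputable def cyclicComplex (I : ℤ → Ideal R) : CochainComplex (FGModuleCat.{u} R) ℤ where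
  X n := FGModuleCat.of R (R ⧸ I n)
  d _ _ := 0

variable [IsNoetherianRing R]

theorem smul_id_homology_cyclicComplex_iff (I : ℤ → Ideal R) (n : ℤ) (s : R) :
    s • 𝟙 ((cyclicComplex I).homology n) = 0 ↔ s ∈ I n := by
  let e : (cyclicComplex I).homology n ≅ FGModuleCat.of R (R ⧸ I n) :=
    (ShortComplex.HomologyData.ofZeros ((cyclicComplex I).sc n) rfl rfl).left.homologyIso
  have : s • 𝟙 ((cyclicComplex I).homology n) = 0 ↔ s • 𝟙 (FGModuleCat.of R (R ⧸ I n)) = 0 :=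
    ⟨smul_id_eq_zero_of_retract e.symm.retract, smul_id_eq_zero_of_retract e.retract⟩
  rw [this, smul_id_eq_zero_iff]
  exact (Ideal.annihilator_quotient (I := I n)).symm ▸ Iff.rfl

end CyclicComplexes

/-! ### The prime thick tensor ideal of a prime of R -/

section PrimeIdeals

variable {R : Type u} [CommRing R] [IsNoetherianRing R]
  [HasDerivedCategory.{w} (FGModuleCat.{u} R)]

open DerivedCategory ZeroObject

variable (p : Ideal R)

/-- The complexes whose cohomology modules are all annihilated by an element outside `p`, i.e.
the complexes that are acyclic after localization at `p`. -/
def locallyAcyclic : ObjectProperty (DerivedCategory (FGModuleCat.{u} R)) :=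
  fun X ↦ ∀ n : ℤ, ∃ s ∉ p, s • 𝟙 ((homologyFunctor _ n).obj X) = 0

theorem locallyAcyclic_Q_obj_iff (K : CochainComplex (FGModuleCat.{u} R) ℤ) :
    locallyAcyclic p (Q.obj K) ↔ ∀ n : ℤ, ∃ s ∉ p, s • 𝟙 (K.homology n) = 0 := by
  have e (n : ℤ) := (homologyFunctorFactors (FGModuleCat.{u} R) n).app K
  refine forall_congr' fun n ↦ exists_congr fun s ↦ and_congr_right fun _ ↦
    ⟨smul_id_eq_zero_of_retract (e n).symm.retract, smul_id_eq_zero_of_retract (e n).retract⟩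

instance : (locallyAcyclic p).IsStableUnderRetracts where
  of_retract e h n := by
    obtain ⟨s, hs, h⟩ := h n
    exact ⟨s, hs, smul_id_eq_zero_of_retract (e.map (homologyFunctor _ n)) h⟩

instance [p.IsPrime] : (locallyAcyclic p).IsTriangulated where
  exists_zero := ⟨0, isZero_zero _, fun n ↦ ⟨1, (Ideal.ne_top_iff_one p).mp Ideal.IsPrime.ne_top',
    ((homologyFunctor _ n).map_isZero (isZero_zero _)).eq_of_src _ _⟩⟩
  isStableUnderShiftBy a := ⟨fun X h n ↦ by
    obtain ⟨s, hs, h⟩ := h (a + n)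
    exact ⟨s, hs, smul_id_eq_zero_of_retract
      (((homologyFunctor (FGModuleCat.{u} R) 0).shiftIso a n (a + n) rfl).app X).retract h⟩⟩
  toIsTriangulatedClosed₂ := .mk' fun T hT h₁ h₃ n ↦ by
    obtain ⟨s, hs, hs'⟩ := h₁ n
    obtain ⟨t, ht, ht'⟩ := h₃ n
    exact ⟨s * t, Ideal.IsPrime.mul_notMem inferInstance hs ht,
      mul_smul_id_eq_zero_of_exact (HomologySequence.exact₂ T hT n) hs' ht'⟩

theorem locallyAcyclic_iff_projRes (X : DMinus.{w} R) :
    locallyAcyclic p X.obj ↔ ∀ n : ℤ, ∃ s ∉ p, s • 𝟙 ((projRes X).complex.homology n) = 0 := by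
  rw [← locallyAcyclic_Q_obj_iff, (locallyAcyclic p).prop_iff_of_iso (projRes X).iso]

/-- The complex `cyclicComplex I` as an object of `DMinus R`. -/
noncomputable def cyclicObject (I : ℤ → Ideal R) (b : ℤ) (hI : ∀ n, b < n → I n = ⊤) :
    DMinus.{w} R :=
  ⟨DerivedCategory.Q.obj (cyclicComplex I), b, ⟨⟨_, Iso.refl _, by
    rw [CochainComplex.isStrictlyLE_iff]
    intro i hi
    have : Subsingleton (R ⧸ I i) := Ideal.Quotient.subsingleton_iff.mpr (hI i hi)
    rw [IsZero.iff_id_eq_zero]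
    exact FGModuleCat.hom_ext (LinearMap.ext fun x ↦ Subsingleton.elim (α := R ⧸ I i) _ _)⟩⟩⟩

theorem locallyAcyclic_cyclicObject_iff (I : ℤ → Ideal R) (b : ℤ)
    (hI : ∀ n, b < n → I n = ⊤) :
    locallyAcyclic p (cyclicObject.{w} I b hI).obj ↔ ∀ n, ¬ I n ≤ p := by
  refine (locallyAcyclic_Q_obj_iff p (cyclicComplex I)).trans (forall_congr' fun n ↦ ?_)
  simp only [smul_id_homology_cyclicComplex_iff, SetLike.not_le_iff_exists, and_comm]

theorem isPrimeThickTensorIdeal_locallyAcyclic [p.IsPrime] :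
    IsPrimeThickTensorIdeal (derivedTensor (R := R))
      ((locallyAcyclic p).inverseImage (Minus.ι (C := FGModuleCat.{u} R))) where
  isTriangulated := inferInstance
  isStableUnderRetracts := ⟨fun e h ↦ (locallyAcyclic p).prop_of_retract (e.map Minus.ι) h⟩
  tensor_mem T X hX := by
    let P := projRes T
    let L := projRes X
    have : HomologicalComplex.HasTensor P.complex L.complex :=
      hasTensor_of_isStrictlyLE _ _ P.bound L.bound P.isStrictlyLE L.isStrictlyLE
    have := P.isStrictlyLE
    have := L.isStrictlyLE
    replace hX := (locallyAcyclic_iff_projRes p X).mp hX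
    refine (locallyAcyclic_Q_obj_iff p (HomologicalComplex.tensorObj P.complex L.complex)).mpr
      fun n ↦ ?_
    obtain ⟨s, hs, f, ⟨h⟩, hf⟩ := exists_homotopy_smul_id L.complex L.bound
      (fun i ↦ have := L.projective i; projective_of_moduleProjective _) p.primeCompl
      (n - P.bound) fun i _ ↦ hX i
    exact ⟨s, hs, tensor_smul_id_eq_zero _ _ P.bound h n hf⟩
  proper := by
    -- R/p in degree 0 is not acyclic at `p`.
    let I (n : ℤ) : Ideal R := if n = 0 then p else ⊤
    have hI (n : ℤ) (hn : 0 < n) : I n = ⊤ := if_neg hn.ne'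
    exact ⟨cyclicObject I 0 hI, fun h ↦
      (locallyAcyclic_cyclicObject_iff p I 0 hI).mp h 0 (if_pos rfl).le⟩
  mem_or_mem X Y h := by
    let P := projRes X
    let L := projRes Y
    have : HomologicalComplex.HasTensor P.complex L.complex :=
      hasTensor_of_isStrictlyLE _ _ P.bound L.bound P.isStrictlyLE L.isStrictlyLE
    have := P.isStrictlyLE
    have := L.isStrictlyLE
    by_contra! hXY
    obtain ⟨a, φ, z, hφ, hz, hzφ⟩ := exists_cocycle_ne_zero P.complex P.bound
      (fun i ↦ have := P.projective i; projective_of_moduleProjective _) p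
      ((locallyAcyclic_iff_projRes p X).not.mp hXY.1)
    obtain ⟨b, ψ, w, hψ, hw, hwψ⟩ := exists_cocycle_ne_zero L.complex L.bound
      (fun i ↦ have := L.projective i; projective_of_moduleProjective _) p
      ((locallyAcyclic_iff_projRes p Y).not.mp hXY.2)
    obtain ⟨s, hs, h⟩ := (locallyAcyclic_Q_obj_iff p
      (HomologicalComplex.tensorObj P.complex L.complex)).mp h (a + b)
    exact hs (exists_smul_id_ne_zero_tensor _ _ p φ hφ ψ hψ z hz hzφ w hw hwψ s h)

end PrimeIdeals

/-! ### Infinite and finite prime spectra of noetherian rings -/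

section PrimeSpectrum

variable (R : Type u) [CommRing R] [IsNoetherianRing R]

/-- An infinite spectrum contains a sequence of primes none of which contains a later one. -/
theorem exists_primeSpectrum_seq_of_infinite [Infinite (PrimeSpectrum R)] :
    ∃ p : ℕ → PrimeSpectrum R, ∀ m n, m < n → ¬ p n ≤ p m := by
  by_contra! h
  -- Without such a sequence, reverse inclusion is a well-quasi-order, so an injective sequence of
  -- primes has a strictly descending subsequence; its heights would descend forever.
  have hwqo : WellQuasiOrdered fun p q : PrimeSpectrum R ↦ q ≤ p := h
  let q := Infinite.natEmbedding (PrimeSpectrum R)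
  obtain ⟨g, hg⟩ := hwqo.exists_monotone_subseq q
  have hlt (n : ℕ) : (q (g (n + 1))).asIdeal.height < (q (g n)).asIdeal.height := by
    refine Ideal.height_strict_mono_of_isPrime (lt_of_le_of_ne (hg _ _ n.le_succ) fun he ↦ ?_)
    have := g.injective (q.injective (PrimeSpectrum.ext he))
    lia
  exact (RelEmbedding.natGT _ hlt).not_wellFounded wellFounded_lt

/-- Each element of `p` lies in a prime of height at most 1 by Krull's principal ideal theorem.
There are finitely many such primes, so prime avoidance puts `p` inside one of them. -/
theorem ringKrullDim_le_one_of_finite_primeSpectrum [Finite (PrimeSpectrum R)] :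
    ringKrullDim R ≤ 1 := by
  refine (ringKrullDim_le_iff_height_le 1).mpr fun p hp ↦ ?_
  let s : Set (PrimeSpectrum R) := {q | q.asIdeal.height ≤ 1}
  have hs : (p : Set R) ⊆ ⋃ q ∈ (s.toFinite.toFinset : Set (PrimeSpectrum R)), (q.asIdeal : Set R) := by
    intro x hx
    obtain ⟨q, hq, hqp⟩ := Ideal.exists_minimalPrimes_le
      ((Ideal.span_singleton_le_iff_mem p).mpr hx)
    have := hq.isPrime
    have hx : x ∈ q := hq.1.2 (Ideal.mem_span_singleton_self x)
    refine Set.mem_iUnion₂.mpr ⟨⟨q, this⟩, ?_, hx⟩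
    exact s.toFinite.mem_toFinset.mpr
      (Ideal.height_le_one_of_isPrincipal_of_mem_minimalPrimes _ q hq)
  obtain ⟨q, hq, hpq⟩ := (Ideal.subset_union_prime ⟨p, hp⟩ ⟨p, hp⟩ fun q _ _ _ ↦ q.isPrime).mp hs
  exact_mod_cast (Ideal.height_mono hpq).trans (s.toFinite.mem_toFinset.mp hq)

end PrimeSpectrum

end BalmerSpectrum

/-! ### The non-compact family of prime tensor ideals -/

theorem theorem3p1 (R : Type u) [CommRing R] [IsNoetherianRing R]
    [HasDerivedCategory.{w} (FGModuleCat.{u} R)]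
    (h : TopologicalSpace.NoetherianSpace (BalmerSpectrum.SpcDMinus.{w} R)) :
    Finite (PrimeSpectrum R) ∧ Finite (MaximalSpectrum R) ∧ ringKrullDim R ≤ 1 := by
  have hfin : Finite (PrimeSpectrum R) := by
    by_contra hinf
    have : Infinite (PrimeSpectrum R) := not_finite_iff_infinite.mp hinf
    obtain ⟨p, hp⟩ := BalmerSpectrum.exists_primeSpectrum_seq_of_infinite R
    -- This places R/p_j in degree -j for each j ≥ m, and zero in all other degrees.
    let I (m : ℕ) (i : ℤ) : Ideal R := if i ≤ -m then (p (-i).toNat).asIdeal else ⊤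
    have hI (m : ℕ) (i : ℤ) (hi : -m < i) : I m i = ⊤ := if_neg hi.not_ge
    let K (m : ℕ) : BalmerSpectrum.DMinus.{w} R :=
      BalmerSpectrum.cyclicObject (I m) (-m) (hI m)
    let P (n : ℕ) : BalmerSpectrum.SpcDMinus.{w} R :=
      ⟨_, BalmerSpectrum.isPrimeThickTensorIdeal_locallyAcyclic (p n).asIdeal⟩
    have hP (m n : ℕ) : (P n).1 (K m) ↔ n < m := by
      refine (BalmerSpectrum.locallyAcyclic_cyclicObject_iff (p n).asIdeal (I m) _ (hI m)).trans
        ⟨fun h0 ↦ ?_, fun hmn i ↦ ?_⟩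
      · by_contra! hmn
        refine h0 (-n) ?_
        simp only [I]
        rw [if_pos (by lia), neg_neg, Int.toNat_natCast]
      · simp only [I]
        split_ifs with hi
        · exact hp n _ (by lia)
        · rw [top_le_iff]
          exact (p n).isPrime.ne_top
    obtain ⟨t, ht⟩ := (TopologicalSpace.NoetherianSpace.isCompact (Set.range P)).elim_finite_subcover
      (fun m ↦ (BalmerSpectrum.Spc.supp _ (K m))ᶜ)
      (fun m ↦ TopologicalSpace.isOpen_generateFrom_of_mem ⟨_, rfl⟩) (by
        rintro _ ⟨n, rfl⟩
        exact Set.mem_iUnion.mpr ⟨n + 1, not_not.mpr ((hP _ _).mpr n.lt_succ_self)⟩)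
    -- The point with index sup t escapes the finite subcover: membership would need sup t < m for
    -- some m in `t`.
    obtain ⟨m, hm, hm'⟩ := Set.mem_iUnion₂.mp (ht ⟨t.sup id, rfl⟩)
    exact ((hP _ _).mp (not_not.mp hm')).not_ge (Finset.le_sup (f := id) hm)
  exact ⟨hfin, Finite.of_injective _ MaximalSpectrum.toPrimeSpectrum_injective,
    BalmerSpectrum.ringKrullDim_le_one_of_finite_primeSpectrum R⟩
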